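/- Let $d,k$ be integers with $1\le k\le d/2$. Let $\Delta_{d,k}\subset\mathbb{R}^d$ be the hypersimplex, i.e. the convex hull of all $(0,1)$-vectors in $\mathbb{R}^d$ whose entries sum to $k$, and let $G_{d,k}$ be its graph: its nodes are the vertices of $\Delta_{d,k}$, and two distinct vertices $x\ne y$ are adjacent if for every $\lambda$ with $0<\lambda<1$ the point $\lambda x+(1-\lambda)y$ is not a convex combination of the other vertices of $\Delta_{d,k}$. For a finite graph $G=(V,E)$ with at least two vertices, the edge expansion is $$\chi(G)=\min\left\{\frac{|\delta(U)|}{|U|}\;:\;U\subseteq V,\ U\neq\emptyset,\ |U|\le\frac{|V|}{2}\right\},$$ where $\delta(U)$ is the set of all edges with one end in $U$ and the other in $V\setminus U$. Then $$\frac d2\;\le\;\chi(G_{d,k})\;\le\;\sqrt{2dk(d-k)}.$$ -/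

import Mathlib

/-- The graph of a convex polytope `P`: its nodes are the vertices (extreme points) of `P`, and two
distinct vertices `x`, `y` are adjacent if no point `t x + (1 - t) y` with `0 < t < 1` is a convex
combination of the other vertices of `P`. -/
def polytopeGraph {E : Type*} [AddCommGroup E] [Module ℝ E] (P : Set E) :
    SimpleGraph (P.extremePoints ℝ) where
  Adj x y := x ≠ y ∧ ∀ t : ℝ, 0 < t → t < 1 →
    t • (x : E) + (1 - t) • (y : E) ∉ convexHull ℝ (P.extremePoints ℝ \ {(x : E), (y : E)})
  symm := ⟨fun x y h => by
    refine ⟨h.1.symm, fun t h0 h1 => ?_⟩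
    have h2 := h.2 (1 - t) (by linarith) (by linarith)
    rwa [sub_sub_cancel, add_comm, Set.pair_comm] at h2⟩
  loopless := ⟨fun _ h => h.1 rfl⟩

/-- The `(0,1)`-vectors in `ℝ^d` whose entries sum to `k`. -/
def zeroOneVectors (d k : ℕ) : Set (Fin d → ℝ) :=
  {x | (∀ i, x i = 0 ∨ x i = 1) ∧ ∑ i, x i = (k : ℝ)}

/-- The hypersimplex `Δ_{d,k}`. -/
def hypersimplex (d k : ℕ) : Set (Fin d → ℝ) :=
  convexHull ℝ (zeroOneVectors d k)

/-- The graph `G_{d,k}` of the hypersimplex `Δ_{d,k}`. -/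
def hypersimplexGraph (d k : ℕ) : SimpleGraph ((hypersimplex d k).extremePoints ℝ) :=
  polytopeGraph (hypersimplex d k)

theorem zeroOneVectors_finite (d k : ℕ) : (zeroOneVectors d k).Finite := by
  refine (Set.Finite.pi' (fun _ : Fin d => Set.toFinite ({0, 1} : Set ℝ))).subset ?_
  intro x hx i
  simpa using hx.1 i

instance hypersimplex_extremePoints_finite (d k : ℕ) :
    Finite ((hypersimplex d k).extremePoints ℝ) :=
  ((zeroOneVectors_finite d k).subset extremePoints_convexHull_subset).to_subtype

/-- `δ(U)`: the set of edges of `G` with one end in `U` and the other one outside `U`. -/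
def edgeBoundary {V : Type*} (G : SimpleGraph V) (U : Set V) : Set (Sym2 V) :=
  {e | e ∈ G.edgeSet ∧ ∃ u ∈ U, ∃ v ∉ U, e = s(u, v)}

/-- The ratios `|δ(U)| / |U|` over all nonempty `U ⊆ V` with `|U| ≤ |V| / 2`. -/
def expansionRatios {V : Type*} [Finite V] (G : SimpleGraph V) : Set ℝ :=
  {q | ∃ U : Set V, U.Nonempty ∧ (U.ncard : ℝ) ≤ (Nat.card V : ℝ) / 2 ∧
    q = ((edgeBoundary G U).ncard : ℝ) / (U.ncard : ℝ)}

/-- The edge expansion `χ(G)` of a finite graph: the least of the ratios `|δ(U)| / |U|`. For a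
graph with at least two vertices there are finitely many ratios and at least one, so that this
infimum is a minimum. -/
noncomputable def edgeExpansion {V : Type*} [Finite V] (G : SimpleGraph V) : ℝ :=
  sInf (expansionRatios G)

/-! The vertices correspond to the k-subsets of a d-set and the edges to single exchanges, so the
graph is the Johnson graph, regular of degree k(d - k).

Lower bound: every eigenvalue on mean-zero functions is at most k(d - k) - d. On level k the
exchange operator is raising after lowering, minus k times the identity, so this gap d amounts to a
norm bound for lowering (`sum_sq_lowerSum_le`), proved by induction on k through the commutator of
raising and lowering. Applied to a centred indicator it gives at least d|U|(1 - |U|/N) boundary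
edges (`johnson_isoperimetric`), hence d|U|/2 when |U| ≤ N/2.

Upper bound: the vertices with one fixed coordinate equal to 1 have ratio d - k
(`sub_mem_expansionRatios`), and (d - k)² ≤ 2dk(d - k). -/

open Finset

/-- The lowering operator on functions on finsets: sum over all supersets with one more element. -/
def lowerSum {α : Type*} [Fintype α] [DecidableEq α] (f : Finset α → ℝ) (B : Finset α) : ℝ :=
  ∑ i ∈ Bᶜ, f (insert i B)

/-- The raising operator on functions on finsets: sum over all subsets with one element less. -/
def raiseSum {α : Type*} [DecidableEq α] (g : Finset α → ℝ) (A : Finset α) : ℝ :=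
  ∑ i ∈ A, g (A.erase i)

/-! ### Raising, lowering and the spectral gap of the Johnson graph -/

section Slices

variable {α : Type*} [Fintype α] [DecidableEq α]

/-- Adjointness of raising and lowering: both sides sum over pairs of a set and a one-element
extension of it. -/
theorem sum_mul_lowerSum (f g : Finset α → ℝ) :
    ∑ B, g B * lowerSum f B = ∑ A, raiseSum g A * f A := by
  simp only [lowerSum, raiseSum, mul_sum, sum_mul]
  rw [sum_sigma', sum_sigma']
  refine sum_bij' (fun p _ => ⟨insert p.2 p.1, p.2⟩) (fun p _ => ⟨p.1.erase p.2, p.2⟩)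
    ?_ ?_ ?_ ?_ ?_
  · simp
  · simp
  · rintro ⟨B, i⟩ h
    simp only [mem_sigma, mem_univ, mem_compl, true_and] at h
    simp [erase_insert h]
  · rintro ⟨A, i⟩ h
    simp only [mem_sigma, mem_univ, true_and] at h
    simp [insert_erase h]
  · rintro ⟨B, i⟩ h
    simp only [mem_sigma, mem_univ, mem_compl, true_and] at h
    simp [erase_insert h]

/-- Sum over all sets obtained from `B` by exchanging one element. -/
def swapSum (g : Finset α → ℝ) (B : Finset α) : ℝ :=
  ∑ j ∈ B, ∑ i ∈ Bᶜ, g (insert i (B.erase j))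

theorem raiseSum_lowerSum (g : Finset α → ℝ) (B : Finset α) :
    raiseSum (lowerSum g) B = #B * g B + swapSum g B := by
  have h : ∀ j ∈ B, lowerSum g (B.erase j) = g B + ∑ i ∈ Bᶜ, g (insert i (B.erase j)) := by
    intro j hj
    rw [lowerSum, compl_erase, sum_insert (by simpa using hj), insert_erase hj]
  rw [raiseSum, sum_congr rfl h, sum_add_distrib, sum_const, nsmul_eq_mul, swapSum]

/-- Together with `raiseSum_lowerSum`, this makes the commutator the scalar d - 2k on level k. -/
theorem lowerSum_raiseSum (g : Finset α → ℝ) (B : Finset α) :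
    lowerSum (raiseSum g) B = (Fintype.card α - #B) * g B + swapSum g B := by
  have h : ∀ i ∈ Bᶜ, raiseSum g (insert i B) = g B + ∑ j ∈ B, g (insert i (B.erase j)) := by
    intro i hi
    have hi' : i ∉ B := by simpa using hi
    rw [raiseSum, sum_insert hi', erase_insert hi']
    congr 1
    refine sum_congr rfl fun j hj => ?_
    rw [erase_insert_of_ne (by rintro rfl; exact hi' hj)]
  rw [lowerSum, sum_congr rfl h, sum_add_distrib, sum_const, nsmul_eq_mul, swapSum, sum_comm,
    card_compl, Nat.cast_sub (card_le_univ B)]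

theorem lowerSum_eq_zero {k : ℕ} {f : Finset α → ℝ} (hf : ∀ A, #A ≠ k + 1 → f A = 0)
    {B : Finset α} (hB : #B ≠ k) : lowerSum f B = 0 := by
  refine sum_eq_zero fun i hi => hf _ ?_
  rw [card_insert_of_notMem (by simpa using hi)]
  omega

theorem sum_lowerSum {k : ℕ} {f : Finset α → ℝ} (hf : ∀ A, #A ≠ k → f A = 0) :
    ∑ B, lowerSum f B = k * ∑ A, f A := by
  have h := sum_mul_lowerSum f (fun _ => 1)
  simp only [one_mul] at h
  rw [h, mul_sum]
  refine sum_congr rfl fun A _ => ?_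
  by_cases hA : #A = k
  · simp [raiseSum, hA]
  · simp [hf A hA]

/-- On functions of mean zero on the `k`-subsets of a `d`-set, the squared norm of the lowering
operator is at most `(k - 1) (d - k)`. -/
theorem sum_sq_lowerSum_le (k : ℕ) (hk : k ≤ Fintype.card α) (f : Finset α → ℝ)
    (hf : ∀ A, #A ≠ k → f A = 0) (h0 : ∑ A, f A = 0) :
    ∑ B, lowerSum f B ^ 2 ≤ (k - 1) * (Fintype.card α - k) * ∑ A, f A ^ 2 := by
  induction k generalizing f with
  | zero =>
    -- The factor k - 1 is -1 here; the bound survives because level 0 is only ∅, where mean zero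
    -- forces f = 0.
    have hz : ∀ A, f A = 0 := by
      intro A
      by_cases hA : A = ∅
      · rw [← h0, sum_eq_single A (fun B _ hB => hf B ?_) (by simp)]
        rw [Ne, card_eq_zero]
        rintro rfl
        exact hB hA.symm
      · exact hf A (by rwa [Ne, card_eq_zero])
    simp [hz, lowerSum]
  | succ k ih =>
    set g := lowerSum f with hg
    have hgs : ∀ B, #B ≠ k → g B = 0 := fun B hB => lowerSum_eq_zero hf hB
    have hg0 : ∑ B, g B = 0 := by rw [hg, sum_lowerSum hf, h0, mul_zero]
    have ihg := ih (by omega) g hgs hg0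
    have e1 : ∑ B, g B ^ 2 = ∑ A, raiseSum g A * f A := by
      rw [← sum_mul_lowerSum]
      exact sum_congr rfl fun B _ => sq _
    have e2 : ∑ A, raiseSum g A ^ 2 =
        (Fintype.card α - 2 * k) * ∑ B, g B ^ 2 + ∑ B, lowerSum g B ^ 2 := by
      have a1 : ∑ A, raiseSum g A ^ 2 = ∑ B, g B * lowerSum (raiseSum g) B := by
        rw [sum_mul_lowerSum]
        exact sum_congr rfl fun B _ => sq _
      have a2 : ∑ B, lowerSum g B ^ 2 = ∑ B, raiseSum (lowerSum g) B * g B := by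
        rw [← sum_mul_lowerSum]
        exact sum_congr rfl fun B _ => sq _
      rw [a1, a2, mul_sum, ← sum_add_distrib]
      refine sum_congr rfl fun B _ => ?_
      rw [lowerSum_raiseSum, raiseSum_lowerSum]
      by_cases hB : #B = k
      · rw [hB]; ring
      · rw [hgs B hB]; ring
    -- Cauchy–Schwarz leaves ‖raise g‖² to bound; by `e2` and induction its factor is (d - 2k) + (k
    -- - 1)(d - k) = k(d - k - 1).
    have cs : (∑ B, g B ^ 2) ^ 2 ≤ (∑ A, raiseSum g A ^ 2) * ∑ A, f A ^ 2 := by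
      rw [e1]
      exact sum_mul_sq_le_sq_mul_sq _ _ _
    have hF : 0 ≤ ∑ A, f A ^ 2 := sum_nonneg fun _ _ => sq_nonneg _
    have hG : 0 ≤ ∑ B, g B ^ 2 := sum_nonneg fun _ _ => sq_nonneg _
    have hkd : ((k + 1 : ℕ) : ℝ) ≤ Fintype.card α := by exact_mod_cast hk
    push_cast at hkd ⊢
    rcases hG.eq_or_lt with h | h
    · rw [← h]
      have : (0 : ℝ) ≤ k := k.cast_nonneg
      exact mul_nonneg (mul_nonneg (by linarith) (by linarith)) hF
    · have up : ∑ A, raiseSum g A ^ 2 ≤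
          (k * (Fintype.card α - (k + 1))) * ∑ B, g B ^ 2 := by
        rw [e2]
        linarith
      have := cs.trans (mul_le_mul_of_nonneg_right up hF)
      refine le_of_mul_le_mul_left ?_ h
      linarith

/-- The isoperimetric inequality for the Johnson graph: a family `U` of `k`-subsets of a `d`-set
has at least `d |U| (1 - |U| / N)` exchanges leaving `U`, where `N` is the number of `k`-subsets. -/
theorem johnson_isoperimetric {k : ℕ} (hk : k ≤ Fintype.card α) (U : Finset (Finset α))
    (hU : ∀ A ∈ U, #A = k) :
    (Fintype.card α : ℝ) * (#U * ((Fintype.card α).choose k - #U)) ≤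
      (Fintype.card α).choose k *
        ∑ A ∈ U, ∑ j ∈ A, ∑ i ∈ Aᶜ, (if insert i (A.erase j) ∈ U then (0 : ℝ) else 1) := by
  set d := Fintype.card α
  obtain ⟨N, hN⟩ : ∃ N : ℝ, N = (d.choose k : ℕ) := ⟨_, rfl⟩
  rw [← hN]
  have hNpos : 0 < N := by rw [hN]; exact_mod_cast Nat.choose_pos hk
  let u : Finset α → ℝ := fun A => if A ∈ U then 1 else 0
  let o : Finset α → ℝ := fun A => if #A = k then 1 else 0
  have hou : ∀ A, o A * u A = u A := by
    intro A
    by_cases h : A ∈ U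
    · simp [u, o, h, hU A h]
    · simp [u, h]
  have hus : ∀ A, #A ≠ k → u A = 0 := fun A hA => by
    simp only [u, ite_eq_right_iff, one_ne_zero, imp_false]
    exact fun h => hA (hU A h)
  have huu : ∀ A, u A * u A = u A := fun A => by simp [u]
  have hoo : ∀ A, o A * o A = o A := fun A => by simp [o]
  have su : ∑ A, u A = #U := by simp [u]
  have so : ∑ A, o A = N := by
    simp only [o, sum_boole, hN]
    congr 1
    rw [← powerset_univ, ← powersetCard_eq_filter, card_powersetCard, card_univ]
  set c : ℝ := #U / N with hc
  -- The density c is the value making u - c·o mean zero on level k.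
  have hcN : c * N = #U := by rw [hc]; field_simp
  let f : Finset α → ℝ := fun A => u A - c * o A
  have hfs : ∀ A, #A ≠ k → f A = 0 := fun A hA => by simp [f, hus A hA, o, hA]
  have hf0 : ∑ A, f A = 0 := by
    simp only [f]
    rw [sum_sub_distrib, ← mul_sum, su, so, hcN, sub_self]
  have main := sum_sq_lowerSum_le k hk f hfs hf0
  have hff : ∑ A, f A ^ 2 = #U - c * #U := by
    have : ∀ A, f A ^ 2 = (1 - 2 * c) * u A + c ^ 2 * o A := fun A => by
      simp only [f]
      linear_combination huu A + c ^ 2 * hoo A - 2 * c * hou A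
    simp only [this]
    rw [sum_add_distrib, ← mul_sum, ← mul_sum, su, so]
    linear_combination c * hcN
  have swo : ∀ A, #A = k → swapSum o A = k * (d - k) := by
    intro A hA
    have : ∀ j ∈ A, ∀ i ∈ Aᶜ, o (insert i (A.erase j)) = 1 := by
      intro j hj i hi
      have hi' : i ∉ A := by simpa using hi
      have : #(insert i (A.erase j)) = k := by
        rw [card_insert_of_notMem (by simp [hi']), card_erase_add_one hj, hA]
      simp [o, this]
    rw [swapSum, sum_congr rfl fun j hj => sum_congr rfl (this j hj)]
    simp [hA, card_compl, Nat.cast_sub hk, d, mul_sub]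
  -- The exchange operator is self-adjoint, so it can be moved onto `o`, where it acts as the
  -- degree.
  have swuo : ∑ A, swapSum u A * o A = k * (d - k) * #U := by
    have h1 : ∑ B, lowerSum u B * lowerSum o B = ∑ A, raiseSum (lowerSum u) A * o A :=
      sum_mul_lowerSum o (lowerSum u)
    have h2 : ∑ B, lowerSum o B * lowerSum u B = ∑ A, raiseSum (lowerSum o) A * u A :=
      sum_mul_lowerSum u (lowerSum o)
    simp only [raiseSum_lowerSum, add_mul, sum_add_distrib] at h1 h2
    have h3 : ∑ A, swapSum o A * u A = k * (d - k) * #U := by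
      rw [← su, mul_sum]
      refine sum_congr rfl fun A _ => ?_
      by_cases hA : #A = k
      · rw [swo A hA]
      · simp [hus A hA]
    have h4 : ∑ B, lowerSum u B * lowerSum o B = ∑ B, lowerSum o B * lowerSum u B :=
      sum_congr rfl fun _ _ => mul_comm _ _
    have h5 : ∑ A, (#A : ℝ) * u A * o A = ∑ A, (#A : ℝ) * o A * u A :=
      sum_congr rfl fun _ _ => mul_right_comm _ _ _
    linarith
  have swuu : ∑ A, swapSum u A * u A = k * (d - k) * #U -
      ∑ A ∈ U, ∑ j ∈ A, ∑ i ∈ Aᶜ, (if insert i (A.erase j) ∈ U then (0 : ℝ) else 1) := by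
    have h1 : ∑ A, swapSum u A * u A = ∑ A ∈ U, swapSum u A := by simp [u]
    have h2 : (k * (d - k) * #U : ℝ) = ∑ A ∈ U, (k * (d - k) : ℝ) := by simp [mul_comm]
    rw [h1, h2, ← sum_sub_distrib]
    refine sum_congr rfl fun A hA => ?_
    rw [← swo A (hU A hA), swapSum, swapSum, ← sum_sub_distrib]
    refine sum_congr rfl fun j hj => ?_
    rw [← sum_sub_distrib]
    refine sum_congr rfl fun i hi => ?_
    have hi' : i ∉ A := by simpa using hi
    have : #(insert i (A.erase j)) = k := by
      rw [card_insert_of_notMem (by simp [hi']), card_erase_add_one hj, hU A hA]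
    simp only [u, o, this]
    split_ifs <;> simp
  have hDf : ∑ B, lowerSum f B ^ 2 = ∑ A, swapSum u A * u A + k * #U
      - c * k * #U - c * (k * (d - k) * #U) := by
    have h1 : ∑ B, lowerSum f B ^ 2 = ∑ A, raiseSum (lowerSum f) A * f A := by
      rw [← sum_mul_lowerSum]
      exact sum_congr rfl fun B _ => sq _
    have h2 : ∀ A, swapSum f A = swapSum u A - c * swapSum o A := fun A => by
      simp only [swapSum, f, sum_sub_distrib, mul_sum]
    have h3 : ∀ A, raiseSum (lowerSum f) A * f A = swapSum u A * u A - c * (swapSum u A * o A)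
        - c * (k * (d - k)) * u A + c ^ 2 * (k * (d - k)) * o A + k * f A ^ 2 := by
      intro A
      rw [raiseSum_lowerSum, h2]
      by_cases hA : #A = k
      · rw [swo A hA, hA]
        simp only [f]
        ring
      · simp [hfs A hA, hus A hA, o, hA]
    rw [h1, sum_congr rfl fun A _ => h3 A]
    simp only [sum_add_distrib, sum_sub_distrib, ← mul_sum]
    rw [su, so, hff, swuo]
    linear_combination c * k * (d - k) * hcN
  rw [hff, hDf, swuu] at main
  have := mul_le_mul_of_nonneg_left main hNpos.le
  rw [← hcN] at this ⊢
  linarith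

end Slices

/-! ### Vertices and edges of the hypersimplex -/

section Geometry

variable {d k : ℕ}

/-- The `(0,1)`-vector with support `A`. -/
def zeroOneVec (A : Finset (Fin d)) : Fin d → ℝ := fun i => if i ∈ A then 1 else 0

theorem zeroOneVec_injective : Function.Injective (zeroOneVec (d := d)) := by
  intro A B h
  ext i
  have := congrFun h i
  by_cases hA : i ∈ A <;> by_cases hB : i ∈ B <;> simp_all [zeroOneVec]

theorem zeroOneVec_mem_iff {A : Finset (Fin d)} :
    zeroOneVec A ∈ zeroOneVectors d k ↔ #A = k := by
  constructor
  · intro h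
    have := h.2
    simp only [zeroOneVec, sum_boole, filter_univ_mem] at this
    exact_mod_cast this
  · intro h
    refine ⟨fun i => ?_, by simp [zeroOneVec, h]⟩
    by_cases hi : i ∈ A <;> simp [zeroOneVec, hi]

theorem exists_zeroOneVec {x : Fin d → ℝ} (hx : x ∈ zeroOneVectors d k) :
    ∃ A : Finset (Fin d), #A = k ∧ zeroOneVec A = x := by
  have h : zeroOneVec (univ.filter fun i => x i = 1) = x := by
    funext i
    rcases hx.1 i with h | h <;> simp [zeroOneVec, h]
  exact ⟨_, zeroOneVec_mem_iff.1 (h.symm ▸ hx), h⟩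

theorem hypersimplex_coord_mem {x : Fin d → ℝ} (hx : x ∈ hypersimplex d k) (i : Fin d) :
    x i ∈ Set.Icc (0 : ℝ) 1 := by
  have hsub : hypersimplex d k ⊆ Set.Icc (0 : Fin d → ℝ) 1 := by
    refine convexHull_min (fun y hy => ⟨fun j => ?_, fun j => ?_⟩) (convex_Icc _ _) <;>
      rcases hy.1 j with h | h <;> simp [h]
  exact ⟨(hsub hx).1 i, (hsub hx).2 i⟩

theorem extremePoints_hypersimplex :
    (hypersimplex d k).extremePoints ℝ = zeroOneVectors d k := by
  refine Set.Subset.antisymm extremePoints_convexHull_subset fun x hx => ?_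
  rw [mem_extremePoints_iff_left]
  refine ⟨subset_convexHull ℝ _ hx, fun y hy z hz hxyz => ?_⟩
  obtain ⟨a, b, ha, hb, hab, rfl⟩ := hxyz
  funext i
  have hyi := hypersimplex_coord_mem hy i
  have hzi := hypersimplex_coord_mem hz i
  have h := hx.1 i
  simp only [Pi.add_apply, Pi.smul_apply, smul_eq_mul, Set.mem_Icc] at *
  rcases h with h | h
  · rw [h]
    have := mul_nonneg ha.le hyi.1
    have := mul_nonneg hb.le hzi.1
    have : a * y i = 0 := by linarith
    exact (mul_eq_zero.1 this).resolve_left ha.ne'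
  · rw [h]
    have := mul_nonneg ha.le (sub_nonneg.2 hyi.2)
    have := mul_nonneg hb.le (sub_nonneg.2 hzi.2)
    have : a * (1 - y i) = 0 := by linarith
    have := (mul_eq_zero.1 this).resolve_left ha.ne'
    linarith

theorem zeroOneVec_mem_extremePoints_iff {A : Finset (Fin d)} :
    zeroOneVec A ∈ (hypersimplex d k).extremePoints ℝ ↔ #A = k := by
  rw [extremePoints_hypersimplex, zeroOneVec_mem_iff]

theorem card_swap {A : Finset (Fin d)} {i j : Fin d} (hj : j ∈ A) (hi : i ∉ A) :
    #(insert i (A.erase j)) = #A := by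
  rw [card_insert_of_notMem (by simp [hi]), card_erase_add_one hj]

/-- A convex combination of the vertices of sets that differ by one exchange is not a convex
combination of other vertices. -/
theorem segment_swap_notMem {A : Finset (Fin d)} {i j : Fin d} (hj : j ∈ A) (hi : i ∉ A)
    (hA : #A = k) (t : ℝ) :
    t • zeroOneVec A + (1 - t) • zeroOneVec (insert i (A.erase j)) ∉
      convexHull ℝ (zeroOneVectors d k \ {zeroOneVec A, zeroOneVec (insert i (A.erase j))}) := by
  set R : Finset (Fin d) := (univ.erase i).erase j with hR
  have hRm : ∀ l, l ∈ R ↔ l ≠ j ∧ l ≠ i := by simp [hR]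
  -- At a vertex with support C, φ plus |A ∩ R| counts the elements of R on which A and C differ.
  -- This vanishes on the whole segment and is positive at every other vertex.
  let φ : (Fin d → ℝ) → ℝ := fun x => ∑ l ∈ R, (1 - 2 * zeroOneVec A l) * x l
  have hφ : IsLinearMap ℝ φ := by
    constructor
    · intro x y
      simp only [φ, ← sum_add_distrib, Pi.add_apply, mul_add]
    · intro c x
      simp only [φ, Pi.smul_apply, smul_eq_mul, mul_sum]
      exact sum_congr rfl fun _ _ => by ring
  have hsub := convexHull_min (𝕜 := ℝ)
    (s := zeroOneVectors d k \ {zeroOneVec A, zeroOneVec (insert i (A.erase j))})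
    (t := {x | -∑ l ∈ R, zeroOneVec A l < φ x}) ?_ (convex_halfSpace_gt hφ _)
  · intro hmem
    have h := hsub hmem
    simp only [Set.mem_ofPred_eq] at h
    refine h.ne ?_
    rw [← sum_neg_distrib]
    refine sum_congr rfl fun l hl => ?_
    obtain ⟨h1, h2⟩ := (hRm l).1 hl
    by_cases hlA : l ∈ A <;> simp [zeroOneVec, hlA, h1, h2] <;> ring
  · rintro x ⟨hx, hne⟩
    obtain ⟨C, hC, rfl⟩ := exists_zeroOneVec hx
    simp only [Set.mem_insert_iff, Set.mem_singleton_iff, zeroOneVec_injective.eq_iff,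
      not_or] at hne
    have hterm : ∀ l, 0 ≤ zeroOneVec A l + (1 - 2 * zeroOneVec A l) * zeroOneVec C l := by
      intro l
      by_cases h1 : l ∈ A <;> by_cases h2 : l ∈ C <;> simp [zeroOneVec, h1, h2]; norm_num
    have hex : ∃ l ∈ R, ¬ (l ∈ C ↔ l ∈ A) := by
      by_contra! hall
      have hAC : ∀ l, l ≠ j → l ≠ i → (l ∈ C ↔ l ∈ A) := fun l h1 h2 => hall l ((hRm l).2 ⟨h1, h2⟩)
      have hij : i ≠ j := by rintro rfl; exact hi hj
      -- Sets of equal size that agree off j also agree at j.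
      have key : ∀ D : Finset (Fin d), #D = k → (∀ l, l ≠ j → l ≠ i → (l ∈ C ↔ l ∈ D)) →
          (i ∈ C ↔ i ∈ D) → C = D := by
        intro D hD hCD hiD
        have he : C.erase j = D.erase j := by
          ext l
          by_cases h1 : l = j
          · simp [h1]
          · by_cases h2 : l = i
            · subst h2; simp [h1, hiD]
            · simp [h1, hCD l h1 h2]
        by_cases hjC : j ∈ C <;> by_cases hjD : j ∈ D
        · rw [← insert_erase hjC, he, insert_erase hjD]
        · have := card_erase_add_one hjC
          rw [he, erase_eq_of_notMem hjD] at this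
          omega
        · have := card_erase_add_one hjD
          rw [← he, erase_eq_of_notMem hjC] at this
          omega
        · rwa [erase_eq_of_notMem hjC, erase_eq_of_notMem hjD] at he
      by_cases hiC : i ∈ C
      · refine hne.2 (key _ ((card_swap hj hi).trans hA) (fun l h1 h2 => ?_) (by simp [hiC]))
        simp [h1, h2, hAC l h1 h2]
      · exact hne.1 (key A hA hAC (by simp [hiC, hi]))
    have hpos : 0 < ∑ l ∈ R, (zeroOneVec A l + (1 - 2 * zeroOneVec A l) * zeroOneVec C l) := by
      obtain ⟨l, hl, hlne⟩ := hex
      refine sum_pos' (fun l _ => hterm l) ⟨l, hl, ?_⟩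
      by_cases h1 : l ∈ A <;> by_cases h2 : l ∈ C <;> simp_all [zeroOneVec]
    rw [sum_add_distrib] at hpos
    simp only [Set.mem_ofPred_eq, φ]
    linarith

theorem hypersimplexGraph_adj_swap {A : Finset (Fin d)} {i j : Fin d} (hj : j ∈ A) (hi : i ∉ A)
    (hA : #A = k) (h1 : zeroOneVec A ∈ (hypersimplex d k).extremePoints ℝ)
    (h2 : zeroOneVec (insert i (A.erase j)) ∈ (hypersimplex d k).extremePoints ℝ) :
    (hypersimplexGraph d k).Adj ⟨zeroOneVec A, h1⟩ ⟨zeroOneVec (insert i (A.erase j)), h2⟩ := by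
  refine ⟨fun h => ?_, fun t _ _ => ?_⟩
  · have h' := zeroOneVec_injective (Subtype.ext_iff.1 h)
    exact hi (h' ▸ mem_insert_self i _)
  · have h := segment_swap_notMem hj hi hA t
    rwa [← extremePoints_hypersimplex] at h

/-- Otherwise A - j + i and B - i + j are two other vertices with the same midpoint as A and B. -/
theorem exists_swap_of_hypersimplexGraph_adj {A B : Finset (Fin d)} (hA : #A = k) (hB : #B = k)
    {h1 : zeroOneVec A ∈ (hypersimplex d k).extremePoints ℝ}
    {h2 : zeroOneVec B ∈ (hypersimplex d k).extremePoints ℝ}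
    (h : (hypersimplexGraph d k).Adj ⟨zeroOneVec A, h1⟩ ⟨zeroOneVec B, h2⟩) :
    ∃ j ∈ A, ∃ i ∉ A, B = insert i (A.erase j) := by
  have hne : A ≠ B := by
    rintro rfl
    exact h.1 rfl
  obtain ⟨j, hjA, hjB⟩ : ∃ j ∈ A, j ∉ B := by
    by_contra! hs
    exact hne (eq_of_subset_of_card_le hs (by omega))
  obtain ⟨i, hiB, hiA⟩ : ∃ i ∈ B, i ∉ A := by
    by_contra! hs
    exact hne (eq_of_subset_of_card_le hs (by omega)).symm
  refine ⟨j, hjA, i, hiA, ?_⟩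
  by_contra hBne
  have hadj : (1 / 2 : ℝ) • zeroOneVec A + (1 - 1 / 2 : ℝ) • zeroOneVec B ∉
      convexHull ℝ ((hypersimplex d k).extremePoints ℝ \ {zeroOneVec A, zeroOneVec B}) :=
    h.2 (1 / 2) (by norm_num) (by norm_num)
  rw [extremePoints_hypersimplex] at hadj
  set C := insert i (A.erase j) with hC
  set D := insert j (B.erase i) with hD
  have hij : i ≠ j := by rintro rfl; exact hiA hjA
  have hCA : C ≠ A := fun e => hiA (e ▸ mem_insert_self i _)
  have hDB : D ≠ B := fun e => hjB (e ▸ mem_insert_self j _)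
  have hDA : D ≠ A := by
    intro e
    apply hBne
    rw [hC, ← e, hD, erase_insert (by simp [hjB]), insert_erase hiB]
  have hCm : zeroOneVec C ∈ zeroOneVectors d k \ {zeroOneVec A, zeroOneVec B} := by
    refine ⟨zeroOneVec_mem_iff.2 ((card_swap hjA hiA).trans hA), ?_⟩
    simpa [zeroOneVec_injective.eq_iff] using ⟨hCA, Ne.symm hBne⟩
  have hDm : zeroOneVec D ∈ zeroOneVectors d k \ {zeroOneVec A, zeroOneVec B} := by
    refine ⟨zeroOneVec_mem_iff.2 ((card_swap hiB hjB).trans hB), ?_⟩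
    simpa [zeroOneVec_injective.eq_iff] using ⟨hDA, hDB⟩
  apply hadj
  have hmid : (1 / 2 : ℝ) • zeroOneVec A + (1 - 1 / 2 : ℝ) • zeroOneVec B =
      (1 / 2 : ℝ) • zeroOneVec C + (1 / 2 : ℝ) • zeroOneVec D := by
    funext l
    by_cases e1 : l = i
    · subst e1; simp [zeroOneVec, hC, hD, hiA, hiB, hij]; norm_num
    · by_cases e2 : l = j
      · subst e2; simp [zeroOneVec, hC, hD, hjA, hjB, e1]
      · simp [zeroOneVec, hC, hD, e1, e2]; norm_num
  simp only [hmid]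
  exact convex_convexHull ℝ _ (subset_convexHull ℝ _ hCm) (subset_convexHull ℝ _ hDm)
    (by norm_num) (by norm_num) (by norm_num)

/-! ### Counting vertices and boundary edges -/

open Classical in
/-- The family of supports of a set of vertices of the hypersimplex. -/
noncomputable def supportFamily (U : Set ((hypersimplex d k).extremePoints ℝ)) :
    Finset (Finset (Fin d)) :=
  univ.filter fun A => ∃ h : zeroOneVec A ∈ (hypersimplex d k).extremePoints ℝ, ⟨_, h⟩ ∈ U

theorem mem_supportFamily {U : Set ((hypersimplex d k).extremePoints ℝ)} {A : Finset (Fin d)} :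
    A ∈ supportFamily U ↔
      ∃ h : zeroOneVec A ∈ (hypersimplex d k).extremePoints ℝ, ⟨_, h⟩ ∈ U := by
  simp [supportFamily]

theorem card_of_mem_supportFamily {U : Set ((hypersimplex d k).extremePoints ℝ)}
    {A : Finset (Fin d)} (hA : A ∈ supportFamily U) : #A = k :=
  zeroOneVec_mem_extremePoints_iff.1 (mem_supportFamily.1 hA).1

theorem exists_eq_zeroOneVec (v : (hypersimplex d k).extremePoints ℝ) :
    ∃ (A : Finset (Fin d)) (h : zeroOneVec A ∈ (hypersimplex d k).extremePoints ℝ),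
      #A = k ∧ v = ⟨zeroOneVec A, h⟩ := by
  obtain ⟨x, hx⟩ := v
  have hx' := hx
  rw [extremePoints_hypersimplex] at hx'
  obtain ⟨A, hA, rfl⟩ := exists_zeroOneVec hx'
  exact ⟨A, hx, hA, rfl⟩

theorem ncard_eq_card_supportFamily (U : Set ((hypersimplex d k).extremePoints ℝ)) :
    U.ncard = #(supportFamily U) := by
  rw [← Set.ncard_coe_finset]
  symm
  refine Set.ncard_congr (fun A hA => ⟨zeroOneVec A, (mem_supportFamily.1 hA).1⟩) ?_ ?_ ?_
  · exact fun A hA => (mem_supportFamily.1 hA).2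
  · exact fun A B hA hB h => zeroOneVec_injective (Subtype.ext_iff.1 h)
  · intro v hv
    obtain ⟨A, h, -, rfl⟩ := exists_eq_zeroOneVec v
    exact ⟨A, mem_supportFamily.2 ⟨h, hv⟩, rfl⟩

theorem card_extremePoints_hypersimplex :
    Nat.card ((hypersimplex d k).extremePoints ℝ) = d.choose k := by
  rw [← Set.ncard_univ, ncard_eq_card_supportFamily]
  have : supportFamily (Set.univ : Set ((hypersimplex d k).extremePoints ℝ)) =
      powersetCard k univ := by
    ext A
    rw [mem_supportFamily]
    simp [zeroOneVec_mem_extremePoints_iff, mem_powersetCard]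
  rw [this, card_powersetCard, card_univ, Fintype.card_fin]

theorem ncard_edgeBoundary_hypersimplexGraph (U : Set ((hypersimplex d k).extremePoints ℝ)) :
    ((edgeBoundary (hypersimplexGraph d k) U).ncard : ℝ) =
      ∑ A ∈ supportFamily U, ∑ j ∈ A, ∑ i ∈ Aᶜ,
        (if insert i (A.erase j) ∈ supportFamily U then (0 : ℝ) else 1) := by
  set S := supportFamily U with hS
  let T : Finset (Σ _ : Finset (Fin d), Σ _ : Fin d, Fin d) :=
    S.sigma fun A => A.sigma fun j => Aᶜ.filter fun i => insert i (A.erase j) ∉ S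
  have hT : ∑ A ∈ S, ∑ j ∈ A, ∑ i ∈ Aᶜ,
      (if insert i (A.erase j) ∈ S then (0 : ℝ) else 1) = #T := by
    simp only [T, card_sigma, Nat.cast_sum]
    refine sum_congr rfl fun A _ => sum_congr rfl fun j _ => ?_
    rw [← sum_boole]
    exact sum_congr rfl fun i _ => by split_ifs <;> simp_all
  have hmem : ∀ p, p ∈ T ↔ p.1 ∈ S ∧ p.2.1 ∈ p.1 ∧ p.2.2 ∉ p.1 ∧
      insert p.2.2 (p.1.erase p.2.1) ∉ S := by
    rintro ⟨A, j, i⟩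
    simp [T]
  rw [hT]
  norm_cast
  rw [← Set.ncard_coe_finset]
  symm
  have hext : ∀ p ∈ T, #(insert p.2.2 (p.1.erase p.2.1)) = k := by
    intro p hp
    obtain ⟨a, b, c, -⟩ := (hmem p).1 hp
    rw [card_swap b c, card_of_mem_supportFamily a]
  refine Set.ncard_congr (fun p hp => s(
      ⟨zeroOneVec p.1, (mem_supportFamily.1 ((hmem p).1 hp).1).1⟩,
      ⟨zeroOneVec (insert p.2.2 (p.1.erase p.2.1)),
        zeroOneVec_mem_extremePoints_iff.2 (hext p hp)⟩)) ?_ ?_ ?_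
  · intro p hp
    obtain ⟨a, b, c, e⟩ := (hmem p).1 hp
    refine ⟨?_, _, (mem_supportFamily.1 a).2, _, fun hU => ?_, rfl⟩
    · rw [SimpleGraph.mem_edgeSet]
      exact hypersimplexGraph_adj_swap b c (card_of_mem_supportFamily a) _ _
    · exact e (mem_supportFamily.2 ⟨_, hU⟩)
  -- The reversed matching of ends is impossible: one end lies in S, the other does not.
  · rintro ⟨A, j, i⟩ ⟨B, j', i'⟩ hp hq h
    obtain ⟨a, b, c, e⟩ := (hmem _).1 hp
    obtain ⟨a', b', c', e'⟩ := (hmem _).1 hq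
    dsimp only at *
    simp only [Sym2.eq_iff, Subtype.mk.injEq, zeroOneVec_injective.eq_iff] at h
    rcases h with ⟨rfl, h⟩ | ⟨h, -⟩
    · have hi : i = i' := by
        have : i ∈ insert i' (A.erase j') := h ▸ mem_insert_self i _
        rcases mem_insert.1 this with h' | h'
        · exact h'
        · exact absurd (mem_of_mem_erase h') c
      subst hi
      have hj : j = j' := by
        have : j ∉ insert i (A.erase j') := by
          rw [← h]
          simp only [mem_insert, mem_erase, ne_eq, not_true_eq_false, false_and, or_false]
          rintro rfl
          exact c b
        simp only [mem_insert, mem_erase, not_or, not_and] at this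
        by_contra hne
        exact this.2 hne b
      subst hj
      rfl
    · exact absurd (h ▸ a) e'
  · rintro e ⟨he, u, hu, v, hv, rfl⟩
    obtain ⟨A, hA, hAk, rfl⟩ := exists_eq_zeroOneVec u
    obtain ⟨B, hB, hBk, rfl⟩ := exists_eq_zeroOneVec v
    rw [SimpleGraph.mem_edgeSet] at he
    obtain ⟨j, hj, i, hi, rfl⟩ := exists_swap_of_hypersimplexGraph_adj hAk hBk he
    refine ⟨⟨A, j, i⟩, (hmem _).2 ⟨mem_supportFamily.2 ⟨hA, hu⟩, hj, hi, fun h => ?_⟩, rfl⟩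
    exact hv (mem_supportFamily.1 h).2

/-- Every expansion ratio of the hypersimplex graph is at least `d / 2`. -/
theorem half_le_of_mem_expansionRatios (hk : k ≤ d) {q : ℝ}
    (hq : q ∈ expansionRatios (hypersimplexGraph d k)) : (d : ℝ) / 2 ≤ q := by
  obtain ⟨U, hne, hcard, rfl⟩ := hq
  have hpos : (0 : ℝ) < U.ncard := by exact_mod_cast hne.ncard_pos
  rw [le_div_iff₀ hpos]
  have iso := johnson_isoperimetric (α := Fin d) (by simpa using hk) (supportFamily U)
    fun _ => card_of_mem_supportFamily
  rw [← ncard_edgeBoundary_hypersimplexGraph, ← ncard_eq_card_supportFamily,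
    Fintype.card_fin] at iso
  rw [card_extremePoints_hypersimplex] at hcard
  have hN : (0 : ℝ) < d.choose k := by exact_mod_cast Nat.choose_pos hk
  refine le_of_mul_le_mul_left (le_trans ?_ iso) hN
  have : 0 ≤ (d : ℝ) * U.ncard * ((d.choose k : ℝ) / 2 - U.ncard) :=
    mul_nonneg (by positivity) (by linarith)
  linarith

/-- The vertices with a fixed coordinate equal to one have expansion ratio `d - k`. -/
theorem sub_mem_expansionRatios (hk : 1 ≤ k) (hkd : 2 * k ≤ d) :
    (d : ℝ) - k ∈ expansionRatios (hypersimplexGraph d k) := by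
  let z : Fin d := ⟨0, by omega⟩
  let U : Set ((hypersimplex d k).extremePoints ℝ) := {v | v.1 z = 1}
  have hS : ∀ A, A ∈ supportFamily U ↔ #A = k ∧ z ∈ A := by
    intro A
    rw [mem_supportFamily]
    simp [zeroOneVec_mem_extremePoints_iff, U, zeroOneVec]
  have hcount : #(supportFamily U) = (d - 1).choose (k - 1) := by
    have hsplit : supportFamily U = powersetCard k univ \ powersetCard k (univ.erase z) := by
      ext A
      rw [hS]
      simp only [mem_sdiff, mem_powersetCard, subset_univ, true_and, subset_erase, not_and]
      tauto
    rw [hsplit, card_sdiff_of_subset (powersetCard_mono (erase_subset _ _)), card_powersetCard,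
      card_powersetCard, card_erase_of_mem (mem_univ z), card_univ, Fintype.card_fin]
    obtain ⟨d', rfl⟩ : ∃ d', d = d' + 1 := ⟨d - 1, by omega⟩
    obtain ⟨k', rfl⟩ : ∃ k', k = k' + 1 := ⟨k - 1, by omega⟩
    simp [Nat.choose_succ_succ]
  -- By Pascal's rule this is C(d-1, k-1) ≤ C(d-1, k), which holds as k ≤ d - k.
  have hhalf : 2 * (d - 1).choose (k - 1) ≤ d.choose k := by
    obtain ⟨d', rfl⟩ : ∃ d', d = d' + 1 := ⟨d - 1, by omega⟩
    obtain ⟨k', rfl⟩ : ∃ k', k = k' + 1 := ⟨k - 1, by omega⟩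
    simp only [Nat.add_sub_cancel, Nat.choose_succ_succ, Nat.succ_eq_add_one]
    have h := Nat.choose_succ_right_eq d' k'
    have h2 : d'.choose k' * (k' + 1) ≤ d'.choose k' * (d' - k') :=
      Nat.mul_le_mul_left _ (by omega)
    have h3 : d'.choose k' ≤ d'.choose (k' + 1) :=
      Nat.le_of_mul_le_mul_right (h2.trans h.ge) (Nat.succ_pos k')
    omega
  have hpos : 0 < (d - 1).choose (k - 1) := Nat.choose_pos (by omega)
  have hncard : U.ncard = (d - 1).choose (k - 1) := by
    rw [ncard_eq_card_supportFamily, hcount]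
  refine ⟨U, Set.nonempty_of_ncard_ne_zero (by omega), ?_, ?_⟩
  · rw [hncard, card_extremePoints_hypersimplex, le_div_iff₀ two_pos]
    exact_mod_cast (by omega : (d - 1).choose (k - 1) * 2 ≤ d.choose k)
  · rw [ncard_edgeBoundary_hypersimplexGraph]
    have hterm : ∀ A ∈ supportFamily U, ∑ j ∈ A, ∑ i ∈ Aᶜ,
        (if insert i (A.erase j) ∈ supportFamily U then (0 : ℝ) else 1) = d - k := by
      intro A hA
      obtain ⟨hAk, hzA⟩ := (hS A).1 hA
      -- An exchange leaves U exactly when it removes z, so each A has d - k of them.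
      have hinner : ∀ j ∈ A, ∀ i ∈ Aᶜ,
          (if insert i (A.erase j) ∈ supportFamily U then (0 : ℝ) else 1) =
            if j = z then 1 else 0 := by
        intro j hj i hi
        have hi' : i ∉ A := by simpa using hi
        have hzi : z ≠ i := by
          intro h
          exact hi' (h ▸ hzA)
        simp only [hS, card_swap hj hi']
        by_cases h : j = z
        · simp [h, hzi]
        · simp [h, hAk, hzA, Ne.symm h]
      rw [sum_congr rfl fun j hj => sum_congr rfl (hinner j hj), sum_comm]
      simp [hzA, card_compl, hAk, Nat.cast_sub (by omega : k ≤ d)]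
    rw [sum_congr rfl hterm, sum_const, nsmul_eq_mul, hcount, hncard]
    have : ((d - 1).choose (k - 1) : ℝ) ≠ 0 := by exact_mod_cast hpos.ne'
    field_simp

end Geometry

theorem expansionRatios_finite {V : Type*} [Finite V] (G : SimpleGraph V) :
    (expansionRatios G).Finite := by
  refine (Set.finite_range fun U : Set V =>
    ((edgeBoundary G U).ncard : ℝ) / (U.ncard : ℝ)).subset ?_
  rintro q ⟨U, -, -, rfl⟩
  exact ⟨U, rfl⟩

theorem proposition9 (d k : ℕ) (hk : 1 ≤ k) (hkd : (k : ℝ) ≤ (d : ℝ) / 2) :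
    IsLeast (expansionRatios (hypersimplexGraph d k)) (edgeExpansion (hypersimplexGraph d k)) ∧
      (d : ℝ) / 2 ≤ edgeExpansion (hypersimplexGraph d k) ∧
      edgeExpansion (hypersimplexGraph d k) ≤
        Real.sqrt (2 * (d : ℝ) * (k : ℝ) * ((d : ℝ) - (k : ℝ))) := by
  have hkd' : 2 * k ≤ d := by
    have : (2 : ℝ) * k ≤ d := by linarith
    exact_mod_cast this
  have hmem := sub_mem_expansionRatios hk hkd'
  have hfin := expansionRatios_finite (hypersimplexGraph d k)
  have hmin : edgeExpansion (hypersimplexGraph d k) ∈ expansionRatios (hypersimplexGraph d k) :=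
    Set.Nonempty.csInf_mem ⟨_, hmem⟩ hfin
  refine ⟨⟨hmin, fun q hq => csInf_le hfin.bddBelow hq⟩,
    half_le_of_mem_expansionRatios (by omega) hmin,
    (csInf_le hfin.bddBelow hmem).trans (Real.le_sqrt_of_sq_le ?_)⟩
  have hk1 : (1 : ℝ) ≤ k := by exact_mod_cast hk
  -- (d - k)² ≤ d(d - k) ≤ 2dk(d - k), using k ≥ 1.
  nlinarith [mul_nonneg (by linarith : (0 : ℝ) ≤ d) (by linarith : (0 : ℝ) ≤ d - k),
    mul_nonneg (mul_nonneg (by linarith : (0 : ℝ) ≤ d) (by linarith : (0 : ℝ) ≤ d - k))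
      (by linarith : (0 : ℝ) ≤ (k : ℝ) - 1),
    mul_nonneg (by linarith : (0 : ℝ) ≤ k) (by linarith : (0 : ℝ) ≤ (d : ℝ) - k)]
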